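/- Let $A\in\mathbb{R}^{n\times n}$, let $P:\mathbb{R}\to\mathbb{R}^{n\times n}$ be $2\pi/\omega$-periodic ($\omega>0$) and square-integrable over a period, and consider, for $\epsilon>0$, the system $\dot x=Ax+\epsilon P(t)x+f(t)$, $x(0)=x_0$. Given a constant matrix $B$, let $\Omega$ solve $$\dot\Omega=\epsilon B\Omega+\epsilon F(t),\quad \Omega(0)=x_0,\qquad F(t)=e^{-At}P(t)e^{At}\int_0^t e^{-A\tau}f(\tau)\,d\tau ,$$ and define the error $E(t,\epsilon)=e^{-At}x(t)-\Omega(t)-\int_0^t e^{-A\tau}f(\tau)\,d\tau$ (differential equations are understood in the Carathéodory sense, i.e. as integral equations for continuous functions). Suppose that $e^{-At}P(t)e^{At}$ is not uniformly bounded in time, in the following sense: there is no constant $K$ with $\|e^{-At}P(t)e^{At}\|\le K(1+\|P(t)\|)$ for almost every $t\ge 0$. (If $P$ is essentially bounded, this says exactly that $e^{-At}P(t)e^{At}$ is not essentially bounded on $[0,\infty)$.) Then for every constant matrix $B$ the $O(\epsilon)$ relative error bound fails, already for $f\equiv 0$: there is an initial condition $x_0\in\mathbb{R}^n$ such that, for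 every $\bar C>0$ (independent of $\epsilon$), there is no constant $C$ independent of $\epsilon$ and $t$ for which, with $f\equiv 0$, $$\|E(t,\epsilon)\|\le C\epsilon\left(\max_{\tau\in[0,t]}\|\Omega(\tau)\|+\max_{\tau\in[0,t]}\left\|\int_0^\tau e^{-As}f(s)\,ds\right\|\right)$$ holds for all sufficiently small $\epsilon>0$ and all $0\le t\le\bar C/\epsilon$. -/

import Mathlib

open scoped Matrix.Norms.L2Operator

noncomputable section

namespace TemporalHomogenization

open MeasureTheory Set

/-- Real `n × n` matrices; the norm in force is the operator norm for the Euclidean norm. -/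
abbrev Mat (n : ℕ) : Type := Matrix (Fin n) (Fin n) ℝ

/-- `ℝⁿ` with the Euclidean norm. -/
abbrev Vec (n : ℕ) : Type := EuclideanSpace ℝ (Fin n)

/-- The product of a matrix and a vector. -/
abbrev act {n : ℕ} (M : Mat n) (v : Vec n) : Vec n :=
  Matrix.toEuclideanCLM (𝕜 := ℝ) M v

/-- `exp(-At) P(t) exp(At)`. -/
def conj {n : ℕ} (A : Mat n) (P : ℝ → Mat n) (t : ℝ) : Mat n :=
  NormedSpace.exp (-(t • A)) * P t * NormedSpace.exp (t • A)

/-- `exp(-At) P(t) exp(At)` is uniformly bounded in time `t ≥ 0`.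

`P` is only an element of `L²`, so the bound is up to null sets and up to the size of `P(t)`
itself: what is excluded is growth in time caused by the conjugation with `exp(At)`, not a
singularity that `P` has inside one period.  If `P` is essentially bounded, the factor
`1 + ‖P t‖` can be replaced by `1`, and this is essential boundedness on `[0, ∞)`. -/
def UniformlyBounded {n : ℕ} (A : Mat n) (P : ℝ → Mat n) : Prop :=
  ∃ K : ℝ, ∀ᵐ t ∂(volume.restrict (Ici (0 : ℝ))), ‖conj A P t‖ ≤ K * (1 + ‖P t‖)

/-- `∫₀ᵗ exp(-Aτ) f(τ) dτ`. -/
def forcing {n : ℕ} (A : Mat n) (f : ℝ → Vec n) (t : ℝ) : Vec n :=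
  ∫ τ in (0 : ℝ)..t, act (NormedSpace.exp (-(τ • A))) (f τ)

/-- `F(t) = exp(-At) P(t) exp(At) ∫₀ᵗ exp(-Aτ) f(τ) dτ`. -/
def cellForcing {n : ℕ} (A : Mat n) (P : ℝ → Mat n) (f : ℝ → Vec n) (t : ℝ) : Vec n :=
  act (conj A P t) (forcing A f t)

/-- `y` is a (Carathéodory) solution on `[0, L]` of `ẏ(t) = g(t, y(t))`, `y(0) = y₀`:
it is continuous and satisfies the integral equation. -/
structure IsSolution {n : ℕ} (g : ℝ → Vec n → Vec n) (y₀ : Vec n) (L : ℝ) (y : ℝ → Vec n) :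
    Prop where
  continuousOn : ContinuousOn y (Icc 0 L)
  integrable : IntervalIntegrable (fun τ => g τ (y τ)) volume 0 L
  eq : ∀ t ∈ Icc (0 : ℝ) L, y t = y₀ + ∫ τ in (0 : ℝ)..t, g τ (y τ)

/-- `x` solves `ẋ = A x + ε P(t) x + f(t)`, `x(0) = x₀`, on `[0, L]`. -/
def SolvesSystem {n : ℕ} (A : Mat n) (P : ℝ → Mat n) (f : ℝ → Vec n) (ε : ℝ) (x₀ : Vec n)
    (L : ℝ) (x : ℝ → Vec n) : Prop :=
  IsSolution (fun t v => act A v + ε • act (P t) v + f t) x₀ L x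

/-- `Ω` solves the cell problem `Ω̇ = ε B Ω + ε F(t)`, `Ω(0) = x₀`, on `[0, L]`. -/
def SolvesCell {n : ℕ} (A : Mat n) (P : ℝ → Mat n) (f : ℝ → Vec n) (B : Mat n) (ε : ℝ)
    (x₀ : Vec n) (L : ℝ) (Ω : ℝ → Vec n) : Prop :=
  IsSolution (fun t v => ε • act B v + ε • cellForcing A P f t) x₀ L Ω

/-- The approximation error `E(t) = exp(-At) x(t) - Ω(t) - ∫₀ᵗ exp(-Aτ) f(τ) dτ`. -/
def err {n : ℕ} (A : Mat n) (f : ℝ → Vec n) (x Ω : ℝ → Vec n) (t : ℝ) : Vec n :=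
  act (NormedSpace.exp (-(t • A))) (x t) - Ω t - forcing A f t

/-- `max_{τ ∈ [0, t]} ‖u(τ)‖`, for continuous `u`. -/
def maxNorm {n : ℕ} (u : ℝ → Vec n) (t : ℝ) : ℝ :=
  sSup ((fun τ => ‖u τ‖) '' Icc 0 t)

/-- The `O(ε)` relative error bound on times of order `1/ε`: some constant `C`, independent of
`ε` and `t`, satisfies
`‖E(t, ε)‖ ≤ C ε (max_{[0,t]} ‖Ω‖ + max_{τ ∈ [0,t]} ‖∫₀^τ exp(-As) f(s) ds‖)`
for all sufficiently small `ε > 0` and all `0 ≤ t ≤ Cbar / ε`. -/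
def RelativeErrorBound {n : ℕ} (A : Mat n) (P : ℝ → Mat n) (f : ℝ → Vec n) (B : Mat n)
    (x₀ : Vec n) (Cbar : ℝ) : Prop :=
  ∃ C : ℝ, ∃ ε₀ > (0 : ℝ), ∀ ε : ℝ, 0 < ε → ε < ε₀ → ∀ x Ω : ℝ → Vec n,
    SolvesSystem A P f ε x₀ (Cbar / ε) x → SolvesCell A P f B ε x₀ (Cbar / ε) Ω →
      ∀ t ∈ Icc (0 : ℝ) (Cbar / ε),
        ‖err A f x Ω t‖ ≤ C * ε * (maxNorm Ω t + maxNorm (forcing A f) t)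

end TemporalHomogenization

end

open scoped Matrix.Norms.L2Operator

noncomputable section

namespace TemporalHomogenization

open MeasureTheory Set Filter Topology

/-! ### Linear Carathéodory equations with square-integrable coefficients. -/

section Analysis

variable {E F : Type*} [NormedAddCommGroup E] [NormedSpace ℝ E]
  [NormedAddCommGroup F] [NormedSpace ℝ F]

/-! Write `Q = conj A P`, `T` for the period, and suppose that every `x₀` admits a bound for some
`Cbar`. With `f = 0`, `y = exp(-At) x` satisfies `y' = ε Q y`, while `Ω = exp(εtB) x₀` stays bounded
for `εt ≤ Cbar`; hence `‖y - Ω‖ ≤ Dε` with `D` independent of `t` and `ε`. Fixing `t`, dividing by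
`ε` and letting `ε → 0` gives `‖∫₀ᵗ Q x₀ - t B x₀‖ ≤ D` for all `t ≥ 0`
(`RelativeErrorBound.exists_norm_integral_sub_le`). Banach–Steinhaus turns this into a bound on the
matrix `∫₀ᵗ Q - tB`.

By periodicity, conjugation by `exp(kTA)` sends `∫₀ᵗ Q` to the integral of `Q` over the interval
shifted by `kT`, which is bounded in `k`. So the primitive of `Q` lies in the subspace of matrices
with bounded orbit (`integral_conj_mem_boundedOrbit`). Differentiating, so does `Q t` for almost
every `t ≥ 0`, and then so does `P t`. On that finite-dimensional subspace the conjugations are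
uniformly bounded, so `‖Q t‖ ≤ K ‖P t‖`, contradicting `hunb`
(`uniformlyBounded_of_norm_integral_sub_le`).

The error bound quantifies over solutions, so it yields nothing until a solution is exhibited: that
is the purpose of the existence theory. -/

theorem integral_exp_mul_le {r : ℝ → ℝ} (hr : Integrable r) (hr2 : Integrable fun s => r s ^ 2)
    {lam del t : ℝ} (hlam : 0 < lam) (hdel : 0 < del) (ht : 0 ≤ t) :
    ∫ s in (0 : ℝ)..t, Real.exp (-(lam * (t - s))) * r s
      ≤ del / 2 * (∫ s, r s ^ 2) + 1 / (4 * lam * del) := by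
  have hc : Continuous fun s : ℝ => Real.exp (-(lam * (t - s))) := by fun_prop
  have hc2 : Continuous fun s : ℝ => Real.exp (-(2 * lam * (t - s))) := by fun_prop
  have hi2 : IntervalIntegrable (fun s => del / 2 * r s ^ 2) volume 0 t :=
    (hr2.const_mul _).intervalIntegrable
  have hi3 : IntervalIntegrable (fun s => 1 / (2 * del) * Real.exp (-(2 * lam * (t - s))))
      volume 0 t := (continuous_const.mul hc2).intervalIntegrable _ _
  -- Young's inequality with weight `del`; the squared exponential is then integrated exactly.
  have h1 : ∫ s in (0 : ℝ)..t, Real.exp (-(lam * (t - s))) * r s ≤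
      ∫ s in (0 : ℝ)..t,
        (del / 2 * r s ^ 2 + 1 / (2 * del) * Real.exp (-(2 * lam * (t - s)))) := by
    refine intervalIntegral.integral_mono_on ht ?_ (hi2.add hi3) fun s _ => ?_
    · exact (hr.intervalIntegrable).continuousOn_mul hc.continuousOn
    · have he : Real.exp (-(2 * lam * (t - s))) = Real.exp (-(lam * (t - s))) ^ 2 := by
        rw [← Real.exp_nat_mul]; congr 1; push_cast; ring
      rw [he]
      set e := Real.exp (-(lam * (t - s)))
      have : del / 2 * r s ^ 2 + 1 / (2 * del) * e ^ 2 - e * r s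
          = (del * r s - e) ^ 2 / (2 * del) := by field_simp; ring
      have : 0 ≤ (del * r s - e) ^ 2 / (2 * del) := by positivity
      linarith
  refine h1.trans ?_
  rw [intervalIntegral.integral_add hi2 hi3]
  refine add_le_add ?_ ?_
  · rw [intervalIntegral.integral_const_mul, intervalIntegral.integral_of_le ht]
    refine mul_le_mul_of_nonneg_left ?_ (by positivity)
    exact setIntegral_le_integral hr2 (Filter.Eventually.of_forall fun s => sq_nonneg _)
  · have hd : ∀ s ∈ uIcc 0 t, HasDerivAt
        (fun s => 1 / (4 * lam * del) * Real.exp (-(2 * lam * (t - s))))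
        (1 / (2 * del) * Real.exp (-(2 * lam * (t - s)))) s := by
      intro s _
      have h0 : HasDerivAt (fun s : ℝ => -(2 * lam * (t - s))) (2 * lam) s := by
        refine (((hasDerivAt_id' s).const_sub t).const_mul (2 * lam)).fun_neg.congr_deriv ?_
        ring
      have := h0.exp.const_mul (1 / (4 * lam * del))
      refine this.congr_deriv ?_
      field_simp
      ring
    rw [intervalIntegral.integral_eq_sub_of_hasDerivAt hd hi3]
    simp only [sub_self, mul_zero, neg_zero, Real.exp_zero, mul_one]
    have : 0 ≤ 1 / (4 * lam * del) * Real.exp (-(2 * lam * (t - 0))) := by positivity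
    linarith

theorem _root_.IntervalIntegrable.clm_apply_continuous {R : ℝ → E →L[ℝ] F} {a b : ℝ}
    (hR : IntervalIntegrable R volume a b) {y : ℝ → E} (hy : Continuous y) :
    IntervalIntegrable (fun s => R s (y s)) volume a b := by
  rw [intervalIntegrable_iff] at hR ⊢
  obtain ⟨C, hC⟩ := (isCompact_uIcc (a := a) (b := b)).exists_bound_of_continuousOn
    hy.continuousOn
  refine Integrable.mono' (hR.norm.mul_const C)
    (isBoundedBilinearMap_apply.continuous.comp_aestronglyMeasurable
      (hR.1.prodMk hy.aestronglyMeasurable)) ?_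
  refine (ae_restrict_mem measurableSet_uIoc).mono fun s hs => ?_
  exact ((R s).le_opNorm _).trans
    (mul_le_mul_of_nonneg_left (hC s (uIoc_subset_uIcc hs)) (norm_nonneg _))

/-- A linear Carathéodory equation with square integrable coefficients has a global solution. -/
theorem exists_linear_integral_equation_of_integrable [CompleteSpace E] {R : ℝ → E →L[ℝ] E}
    (hR : Integrable R) (hR2 : Integrable fun s => ‖R s‖ ^ 2) {L : ℝ} (hL : 0 ≤ L) (x₀ : E) :
    ∃ y : ℝ → E, Continuous y ∧ ∀ t ∈ Icc 0 L, y t = x₀ + ∫ s in (0 : ℝ)..t, R s (y s) := by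
  set S := ∫ s, ‖R s‖ ^ 2 with hS
  have hS0 : 0 ≤ S := integral_nonneg fun s => sq_nonneg _
  -- With `lam = 1 / del`, both terms of `integral_exp_mul_le` are at most `1/4`, so the contraction
  -- constant is `1/2`.
  set del : ℝ := 1 / (2 * (S + 1)) with hdel
  have hdel0 : 0 < del := by positivity
  set lam : ℝ := 1 / del with hlam
  have hlam0 : 0 < lam := by positivity
  have hint (y : ℝ → E) (hy : Continuous y) (a b : ℝ) :
      IntervalIntegrable (fun s => R s (y s)) volume a b :=
    hR.intervalIntegrable.clm_apply_continuous hy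
  -- The unknown is `z(t) = exp(-lam t) y(t)`: the sup norm of `z` is a weighted norm of `y`, which
  -- makes the Picard map contract on all of `[0, L]` at once.
  let ext (z : C(Icc (0 : ℝ) L, E)) (s : ℝ) : E := Real.exp (lam * s) • z (projIcc 0 L hL s)
  have hext (z) : Continuous (ext z) := by
    have : Continuous fun s => z (projIcc 0 L hL s) := z.continuous.comp continuous_projIcc
    exact (by fun_prop : Continuous fun s : ℝ => Real.exp (lam * s)).smul this
  have hprim (z) : Continuous fun t => ∫ s in (0 : ℝ)..t, R s (ext z s) :=
    intervalIntegral.continuous_primitive (hint _ (hext z)) 0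
  let Φ (z : C(Icc (0 : ℝ) L, E)) : C(Icc (0 : ℝ) L, E) :=
    ⟨fun t => Real.exp (-(lam * t)) • (x₀ + ∫ s in (0 : ℝ)..t, R s (ext z s)), by
      have h1 : Continuous fun t : Icc (0 : ℝ) L => Real.exp (-(lam * t)) := by fun_prop
      exact h1.smul (continuous_const.add ((hprim z).comp continuous_subtype_val))⟩
  have hΦ : ContractingWith (1 / 2) Φ := by
    refine ⟨by rw [← NNReal.coe_lt_coe]; norm_num, LipschitzWith.of_dist_le_mul fun z w => ?_⟩
    rw [ContinuousMap.dist_le (by positivity)]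
    rintro ⟨t, ht⟩
    have hsub : (Φ z) ⟨t, ht⟩ - (Φ w) ⟨t, ht⟩ = Real.exp (-(lam * t)) •
        ∫ s in (0 : ℝ)..t, R s (ext z s - ext w s) := by
      simp only [Φ, ContinuousMap.coe_mk, ← smul_sub, add_sub_add_left_eq_sub, map_sub]
      rw [intervalIntegral.integral_sub (hint _ (hext z) _ _) (hint _ (hext w) _ _)]
    rw [dist_eq_norm, hsub, ← intervalIntegral.integral_smul]
    have hle : ‖∫ s in (0 : ℝ)..t, Real.exp (-(lam * t)) • R s (ext z s - ext w s)‖ ≤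
        ∫ s in (0 : ℝ)..t, Real.exp (-(lam * (t - s))) * ‖R s‖ * dist z w := by
      refine intervalIntegral.norm_integral_le_of_norm_le ht.1
        (Filter.Eventually.of_forall fun s hs => ?_) ?_
      · have h1 : ext z s - ext w s = Real.exp (lam * s) •
            (z (projIcc 0 L hL s) - w (projIcc 0 L hL s)) := by simp only [ext, smul_sub]
        rw [h1, map_smul, smul_smul, ← Real.exp_add, norm_smul, Real.norm_eq_abs,
          Real.abs_exp, mul_assoc, show -(lam * t) + lam * s = -(lam * (t - s)) by ring]
        refine mul_le_mul_of_nonneg_left (((R s).le_opNorm _).trans ?_) (Real.exp_pos _).le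
        refine mul_le_mul_of_nonneg_left ?_ (norm_nonneg _)
        rw [← dist_eq_norm]
        exact ContinuousMap.dist_apply_le_dist _
      · refine IntervalIntegrable.mul_const ?_ _
        exact hR.norm.intervalIntegrable.continuousOn_mul (by fun_prop)
    refine hle.trans ?_
    rw [intervalIntegral.integral_mul_const]
    refine mul_le_mul_of_nonneg_right ?_ dist_nonneg
    refine (integral_exp_mul_le hR.norm hR2 hlam0 hdel0 ht.1).trans ?_
    rw [← hS]
    have h1 : del / 2 * S ≤ 1 / 4 := by
      rw [hdel]; field_simp; linarith
    have h2 : 1 / (4 * lam * del) = 1 / 4 := by rw [hlam]; field_simp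
    rw [h2]; push_cast; linarith
  obtain ⟨z, hz⟩ : ∃ z, Φ z = z := ⟨_, hΦ.fixedPoint_isFixedPt⟩
  refine ⟨ext z, hext z, fun t ht => ?_⟩
  have h1 : z ⟨t, ht⟩ = Real.exp (-(lam * t)) • (x₀ + ∫ s in (0 : ℝ)..t, R s (ext z s)) := by
    conv_lhs => rw [← hz]
    rfl
  calc ext z t = Real.exp (lam * t) • z ⟨t, ht⟩ := by simp only [ext, projIcc_of_mem hL ht]
    _ = _ := by rw [h1, smul_smul, ← Real.exp_add, add_neg_cancel, Real.exp_zero, one_smul]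

theorem exists_linear_integral_equation [CompleteSpace E] {R : ℝ → E →L[ℝ] E} {L : ℝ}
    (hL : 0 ≤ L) (hR : IntervalIntegrable R volume 0 L)
    (hR2 : IntervalIntegrable (fun s => ‖R s‖ ^ 2) volume 0 L) (x₀ : E) :
    ∃ y : ℝ → E, Continuous y ∧ ∀ t ∈ Icc 0 L, y t = x₀ + ∫ s in (0 : ℝ)..t, R s (y s) := by
  rw [intervalIntegrable_iff_integrableOn_Ioc_of_le hL] at hR hR2
  obtain ⟨y, hy, h⟩ := exists_linear_integral_equation_of_integrable
    (R := (Ioc 0 L).indicator R) (hR.integrable_indicator measurableSet_Ioc) (by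
      refine (hR2.integrable_indicator measurableSet_Ioc).congr
        (Filter.Eventually.of_forall fun s => ?_)
      by_cases hs : s ∈ Ioc 0 L <;> simp [hs]) hL x₀
  refine ⟨y, hy, fun t ht => ?_⟩
  rw [h t ht]
  congr 1
  refine intervalIntegral.integral_congr_ae (Filter.Eventually.of_forall fun s hs => ?_)
  rw [uIoc_of_le ht.1] at hs
  simp [show s ∈ Ioc 0 L from ⟨hs.1, hs.2.trans ht.2⟩]

omit [NormedSpace ℝ E] in
theorem _root_.IntervalIntegrable.of_mem_Icc {f : ℝ → E} {L a b : ℝ} (hL : 0 ≤ L)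
    (hf : IntervalIntegrable f volume 0 L) (ha : a ∈ Icc 0 L) (hb : b ∈ Icc 0 L) :
    IntervalIntegrable f volume a b :=
  hf.mono_set (uIcc_subset_uIcc (by rwa [uIcc_of_le hL]) (by rwa [uIcc_of_le hL]))

theorem _root_.AbsolutelyContinuousOnInterval.of_dist_le {X Y : Type*} [PseudoMetricSpace X]
    [PseudoMetricSpace Y] {f : ℝ → X} {g : ℝ → Y} {a b : ℝ}
    (hg : AbsolutelyContinuousOnInterval g a b)
    (h : ∀ s ∈ uIcc a b, ∀ t ∈ uIcc a b, dist (f s) (f t) ≤ dist (g s) (g t)) :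
    AbsolutelyContinuousOnInterval f a b := by
  rw [absolutelyContinuousOnInterval_iff] at hg ⊢
  intro ε hε
  obtain ⟨δ, hδ, H⟩ := hg ε hε
  refine ⟨δ, hδ, fun I hI hI' => lt_of_le_of_lt (Finset.sum_le_sum fun i hi => ?_) (H I hI hI')⟩
  have := hI.1 i hi
  exact h _ this.1 _ this.2

/-- Leibniz rule for a continuously differentiable operator function applied to a primitive. -/
theorem clm_apply_primitive_eq_integral [CompleteSpace E] [CompleteSpace F]
    {M M' : ℝ → E →L[ℝ] F} (hM : ∀ t, HasDerivAt M (M' t) t) (hM' : Continuous M') {g y : ℝ → E}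
    {L : ℝ} (hL : 0 ≤ L) (hg : IntervalIntegrable g volume 0 L) {y₀ : E} (hyc : Continuous y)
    (hy : ∀ t ∈ Icc 0 L, y t = y₀ + ∫ s in (0 : ℝ)..t, g s) :
    IntervalIntegrable (fun s => M' s (y s) + M s (g s)) volume 0 L ∧
    ∀ t ∈ Icc 0 L, M t (y t) = M 0 y₀ + ∫ s in (0 : ℝ)..t, (M' s (y s) + M s (g s)) := by
  have hMc : Continuous M := continuous_iff_continuousAt.2 fun t => (hM t).continuousAt
  obtain ⟨C, hC⟩ := (isCompact_Icc (a := 0) (b := L)).exists_bound_of_continuousOn hMc.continuousOn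
  have hi2 : IntervalIntegrable (fun s => M s (g s)) volume 0 L := by
    rw [intervalIntegrable_iff_integrableOn_Ioc_of_le hL] at hg ⊢
    refine Integrable.mono' (hg.norm.const_mul C)
      (isBoundedBilinearMap_apply.continuous.comp_aestronglyMeasurable
        (hMc.aestronglyMeasurable.prodMk hg.1)) ?_
    refine (ae_restrict_mem measurableSet_Ioc).mono fun s hs => ?_
    exact ((M s).le_opNorm _).trans
      (mul_le_mul_of_nonneg_right (hC s (Ioc_subset_Icc_self hs)) (norm_nonneg _))
  have hi1 : IntervalIntegrable (fun s => M' s (y s)) volume 0 L :=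
    (hM'.clm_apply hyc).intervalIntegrable _ _
  have hi := hi1.add hi2
  refine ⟨hi, ?_⟩
  -- the defect `D` is absolutely continuous with zero derivative
  set D : ℝ → F := fun t => M t (y t) - ∫ s in (0 : ℝ)..t, (M' s (y s) + M s (g s)) with hD
  obtain ⟨C₁, hC₁⟩ := (isCompact_Icc (a := 0) (b := L)).exists_bound_of_continuousOn
    hM'.continuousOn
  obtain ⟨C₂, hC₂⟩ := (isCompact_Icc (a := 0) (b := L)).exists_bound_of_continuousOn
    hyc.continuousOn
  -- An integrable majorant for the increments of `D`, one summand for each term of the splitting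
  -- `hDd`.
  set h : ℝ → ℝ := fun s => C₁ * C₂ + C * ‖g s‖ + ‖M' s (y s) + M s (g s)‖
  have hhi : IntervalIntegrable h volume 0 L :=
    ((intervalIntegrable_const).add (hg.norm.const_mul C)).add hi.norm
  have h0L : (0 : ℝ) ∈ uIcc 0 L := left_mem_uIcc
  have h0 : (0 : ℝ) ∈ Icc 0 L := ⟨le_rfl, hL⟩
  have key : ∀ a ∈ Icc 0 L, ∀ b ∈ Icc 0 L, a ≤ b → ‖D b - D a‖ ≤ ∫ s in a..b, h s := by
    intro a ha b hb hab
    have hyd : y b - y a = ∫ s in a..b, g s := by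
      rw [hy a ha, hy b hb, add_sub_add_left_eq_sub,
        intervalIntegral.integral_interval_sub_left (hg.of_mem_Icc hL h0 hb) (hg.of_mem_Icc hL h0 ha)]
    have hDd : D b - D a = (M b - M a) (y b) + M a (∫ s in a..b, g s) -
        ∫ s in a..b, (M' s (y s) + M s (g s)) := by
      rw [← intervalIntegral.integral_interval_sub_left (hi.of_mem_Icc hL h0 hb)
        (hi.of_mem_Icc hL h0 ha), ← hyd, hD]
      simp only [sub_apply, map_sub]
      abel
    have hMd : ‖M b - M a‖ ≤ C₁ * (b - a) := by
      have := (convex_Icc 0 L).norm_image_sub_le_of_norm_hasDerivWithin_le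
        (fun t _ => (hM t).hasDerivWithinAt) hC₁ ha hb
      rwa [Real.norm_of_nonneg (sub_nonneg.2 hab)] at this
    have hga := hg.of_mem_Icc hL ha hb
    have n1 : ‖(M b - M a) (y b)‖ ≤ C₁ * C₂ * (b - a) := by
      refine ((M b - M a).le_opNorm _).trans ?_
      have := mul_le_mul hMd (hC₂ b hb) (norm_nonneg _) ((norm_nonneg _).trans hMd)
      linarith
    have n2 : ‖M a (∫ s in a..b, g s)‖ ≤ C * ∫ s in a..b, ‖g s‖ := by
      refine ((M a).le_opNorm _).trans ?_
      exact mul_le_mul (hC a ha) (intervalIntegral.norm_integral_le_integral_norm hab)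
        (norm_nonneg _) ((norm_nonneg _).trans (hC a ha))
    have n3 : ‖∫ s in a..b, (M' s (y s) + M s (g s))‖ ≤ ∫ s in a..b, ‖M' s (y s) + M s (g s)‖ :=
      intervalIntegral.norm_integral_le_integral_norm hab
    have hint : ∫ s in a..b, h s = C₁ * C₂ * (b - a) + C * (∫ s in a..b, ‖g s‖) +
        ∫ s in a..b, ‖M' s (y s) + M s (g s)‖ := by
      rw [intervalIntegral.integral_add (intervalIntegrable_const.add (hga.norm.const_mul C))
        (hi.of_mem_Icc hL ha hb).norm, intervalIntegral.integral_add intervalIntegrable_const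
        (hga.norm.const_mul C), intervalIntegral.integral_const,
        intervalIntegral.integral_const_mul C, smul_eq_mul, mul_comm (b - a)]
    rw [hDd, hint]
    exact (norm_sub_le _ _).trans (add_le_add ((norm_add_le _ _).trans (add_le_add n1 n2)) n3)
  have hAC : AbsolutelyContinuousOnInterval D 0 L := by
    refine (hhi.absolutelyContinuousOnInterval_intervalIntegral (c := 0) h0L).of_dist_le ?_
    rw [uIcc_of_le hL]
    have : ∀ a ∈ Icc 0 L, ∀ b ∈ Icc 0 L, a ≤ b → dist (D a) (D b) ≤
        dist (∫ s in (0 : ℝ)..a, h s) (∫ s in (0 : ℝ)..b, h s) := by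
      intro a ha b hb hab
      rw [dist_comm, dist_comm (∫ s in (0 : ℝ)..a, h s), dist_eq_norm, Real.dist_eq,
        intervalIntegral.integral_interval_sub_left (hhi.of_mem_Icc hL h0 hb)
          (hhi.of_mem_Icc hL h0 ha)]
      exact (key a ha b hb hab).trans (le_abs_self _)
    intro a ha b hb
    rcases le_total a b with hab | hab
    · exact this a ha b hb hab
    · rw [dist_comm, dist_comm (∫ s in (0 : ℝ)..a, h s)]; exact this b hb a ha hab
  have hder : ∀ᵐ t, t ∈ uIcc 0 L → HasDerivAt D 0 t := by
    -- Endpoints are discarded because `y` is known to be a primitive only on `[0, L]`, while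
    -- two-sided derivatives are needed.
    have e0 : ∀ᵐ t : ℝ, t ≠ 0 := by simp [ae_iff, measure_singleton]
    have eL : ∀ᵐ t : ℝ, t ≠ L := by simp [ae_iff, measure_singleton]
    filter_upwards [hg.ae_hasDerivAt_integral, hi.ae_hasDerivAt_integral, e0, eL]
      with t h1 h2 ht0 htL ht
    have hyt : HasDerivAt y (g t) t := by
      refine ((h1 ht 0 h0L).const_add y₀).congr_of_eventuallyEq ?_
      rw [uIcc_of_le hL] at ht
      filter_upwards [Icc_mem_nhds (lt_of_le_of_ne ht.1 ht0.symm) (lt_of_le_of_ne ht.2 htL)]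
        with s hs using hy s hs
    exact (((hM t).clm_apply hyt).fun_sub (h2 ht 0 h0L)).congr_deriv (sub_self _)
  intro t ht
  obtain ⟨K, hK⟩ := hAC.const_of_ae_hasDerivAt_zero hder
  have h1 : D t = D 0 := by rw [hK t (by rwa [uIcc_of_le hL]), hK 0 h0L]
  have h2 : D 0 = M 0 y₀ := by simp [hD, hy 0 h0]
  rw [← h2, ← h1, hD]
  exact (sub_add_cancel _ _).symm

end Analysis

/-! ### Explicit solutions through matrix exponentials. -/

section Flow

variable {n : ℕ}

/-- Matrices acting on vectors, as a continuous linear map. -/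
def actL (n : ℕ) : Mat n →L[ℝ] Vec n →L[ℝ] Vec n :=
  LinearMap.mkContinuous
    ((Matrix.toEuclideanCLM (n := Fin n) (𝕜 := ℝ)).toAlgEquiv.toLinearMap) 1
    (fun M => by rw [one_mul]; exact (Matrix.l2_opNorm_toEuclideanCLM M).le)

theorem actL_apply (M : Mat n) (v : Vec n) : actL n M v = act M v := rfl

theorem act_mul (M N : Mat n) (v : Vec n) : act (M * N) v = act M (act N v) := by
  simp [act]

theorem act_one (v : Vec n) : act (1 : Mat n) v = v := by simp [act]

theorem norm_act_le (M : Mat n) (v : Vec n) : ‖act M v‖ ≤ ‖M‖ * ‖v‖ := by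
  have := (Matrix.toEuclideanCLM (n := Fin n) (𝕜 := ℝ) M).le_opNorm v
  rwa [Matrix.l2_opNorm_toEuclideanCLM] at this

theorem exp_neg_mul_exp (A : Mat n) : NormedSpace.exp (-A) * NormedSpace.exp A = 1 := by
  rw [← Matrix.exp_add_of_commute _ _ (Commute.refl A).neg_left, neg_add_cancel,
    NormedSpace.exp_zero]

theorem exp_mul_exp_neg (A : Mat n) : NormedSpace.exp A * NormedSpace.exp (-A) = 1 := by
  rw [← Matrix.exp_add_of_commute _ _ (Commute.refl A).neg_right, add_neg_cancel,
    NormedSpace.exp_zero]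

theorem exp_add_smul (A : Mat n) (s t : ℝ) :
    NormedSpace.exp ((s + t) • A) = NormedSpace.exp (s • A) * NormedSpace.exp (t • A) := by
  rw [add_smul, Matrix.exp_add_of_commute]
  exact ((Commute.refl A).smul_left s).smul_right t

theorem hasDerivAt_exp_smul (A : Mat n) (t : ℝ) :
    HasDerivAt (fun t : ℝ => NormedSpace.exp (t • A)) (A * NormedSpace.exp (t • A)) t :=
  hasDerivAt_exp_smul_const' A t

theorem continuous_exp_smul (A : Mat n) : Continuous fun t : ℝ => NormedSpace.exp (t • A) :=
  continuous_iff_continuousAt.2 fun t => (hasDerivAt_exp_smul A t).continuousAt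

theorem continuous_exp_neg_smul (A : Mat n) :
    Continuous fun t : ℝ => NormedSpace.exp (-(t • A)) := by
  simpa only [smul_neg] using continuous_exp_smul (-A)

theorem hasDerivAt_actL_exp_smul (A : Mat n) (t : ℝ) :
    HasDerivAt (fun t : ℝ => actL n (NormedSpace.exp (t • A)))
      (actL n (A * NormedSpace.exp (t • A))) t :=
  (actL n).hasFDerivAt.comp_hasDerivAt t (hasDerivAt_exp_smul A t)

theorem intervalIntegrable_conj {A : Mat n} {P : ℝ → Mat n} {a b : ℝ}
    (hP : IntervalIntegrable P volume a b) : IntervalIntegrable (conj A P) volume a b :=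
  (hP.continuousOn_mul (continuous_exp_neg_smul A).continuousOn).mul_continuousOn
    (continuous_exp_smul A).continuousOn

theorem intervalIntegrable_norm_conj_sq {A : Mat n} {P : ℝ → Mat n} {a b : ℝ}
    (hP : IntervalIntegrable P volume a b)
    (hP2 : IntervalIntegrable (fun s => ‖P s‖ ^ 2) volume a b) :
    IntervalIntegrable (fun s => ‖conj A P s‖ ^ 2) volume a b := by
  have hc : Continuous fun s : ℝ =>
      (‖NormedSpace.exp (-(s • A))‖ * ‖NormedSpace.exp (s • A)‖) ^ 2 :=
    ((continuous_exp_neg_smul A).norm.mul (continuous_exp_smul A).norm).pow 2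
  refine (hP2.continuousOn_mul hc.continuousOn).mono_fun
    ((intervalIntegrable_conj hP).def'.1.norm.pow 2)
    (Eventually.of_forall fun s => ?_)
  simp only [norm_pow, norm_norm, norm_mul, ← mul_pow]
  gcongr
  calc ‖conj A P s‖ ≤ ‖NormedSpace.exp (-(s • A))‖ * ‖P s‖ * ‖NormedSpace.exp (s • A)‖ :=
        norm_mul₃_le
    _ = _ := by ring

/-- The system is solvable, and its solution has the variation-of-constants form. -/
theorem exists_solvesSystem (A : Mat n) {P : ℝ → Mat n} (ε : ℝ) (x₀ : Vec n) {L : ℝ} (hL : 0 ≤ L)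
    (hP : IntervalIntegrable P volume 0 L)
    (hP2 : IntervalIntegrable (fun s => ‖P s‖ ^ 2) volume 0 L) :
    ∃ y : ℝ → Vec n, Continuous y ∧
      (∀ t ∈ Icc 0 L, y t = x₀ + ε • ∫ s in (0 : ℝ)..t, act (conj A P s) (y s)) ∧
      SolvesSystem A P 0 ε x₀ L fun t => act (NormedSpace.exp (t • A)) (y t) := by
  have hQ := intervalIntegrable_conj (A := A) hP
  have hR : IntervalIntegrable (fun s => ε • actL n (conj A P s)) volume 0 L := by
    have h : IntervalIntegrable (fun s => actL n (conj A P s)) volume 0 L :=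
      ⟨(actL n).integrable_comp hQ.1, (actL n).integrable_comp hQ.2⟩
    exact h.smul ε
  have hR2 : IntervalIntegrable (fun s => ‖ε • actL n (conj A P s)‖ ^ 2) volume 0 L := by
    refine ((intervalIntegrable_norm_conj_sq (A := A) hP hP2).const_mul (ε ^ 2)).congr
      (fun s _ => ?_)
    have : ‖actL n (conj A P s)‖ = ‖conj A P s‖ := Matrix.l2_opNorm_toEuclideanCLM _
    simp only [norm_smul, this, mul_pow, Real.norm_eq_abs, sq_abs]
  obtain ⟨y, hyc, hy⟩ := exists_linear_integral_equation hL hR hR2 x₀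
  have hg : IntervalIntegrable (fun s => (ε • actL n (conj A P s)) (y s)) volume 0 L :=
    hR.clm_apply_continuous hyc
  obtain ⟨hi, hx⟩ := clm_apply_primitive_eq_integral (hasDerivAt_actL_exp_smul A)
    ((actL n).continuous.comp (continuous_const.mul (continuous_exp_smul A))) hL hg hyc hy
  have hrhs (s : ℝ) : actL n (A * NormedSpace.exp (s • A)) (y s) +
      actL n (NormedSpace.exp (s • A)) ((ε • actL n (conj A P s)) (y s)) =
      act A (act (NormedSpace.exp (s • A)) (y s)) +
        ε • act (P s) (act (NormedSpace.exp (s • A)) (y s)) + (0 : ℝ → Vec n) s := by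
    rw [Pi.zero_apply, add_zero, smul_apply, map_smul]
    simp only [actL_apply, ← act_mul, conj]
    rw [← mul_assoc, ← mul_assoc, exp_mul_exp_neg, one_mul]
  simp only [hrhs] at hi hx
  refine ⟨y, hyc, fun t ht => ?_, ?_, hi, fun t ht => ?_⟩
  · rw [hy t ht, ← intervalIntegral.integral_smul]; rfl
  · exact (((actL n).continuous.comp (continuous_exp_smul A)).clm_apply hyc).continuousOn
  · refine (hx t ht).trans ?_
    rw [zero_smul, NormedSpace.exp_zero, actL_apply, act_one]

theorem solvesCell_exp (A : Mat n) (P : ℝ → Mat n) (B : Mat n) (ε : ℝ) (x₀ : Vec n) (L : ℝ) :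
    SolvesCell A P 0 B ε x₀ L fun t => act (NormedSpace.exp (t • (ε • B))) x₀ := by
  have hd (t : ℝ) : HasDerivAt (fun t => act (NormedSpace.exp (t • (ε • B))) x₀)
      (ε • act B (act (NormedSpace.exp (t • (ε • B))) x₀) + ε • cellForcing A P 0 t) t := by
    refine ((hasDerivAt_actL_exp_smul (ε • B) t).clm_apply (hasDerivAt_const t x₀)).congr_deriv ?_
    simp [cellForcing, forcing, actL_apply, act]
  have hc : Continuous fun t => act (NormedSpace.exp (t • (ε • B))) x₀ :=
    continuous_iff_continuousAt.2 fun t => (hd t).continuousAt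
  have hi (a b : ℝ) : IntervalIntegrable (fun t => ε • act B (act (NormedSpace.exp (t • (ε • B))) x₀)
      + ε • cellForcing A P 0 t) volume a b := by
    refine Continuous.intervalIntegrable ?_ _ _
    have : Continuous fun t => ε • actL n B (act (NormedSpace.exp (t • (ε • B))) x₀) :=
      ((actL n B).continuous.comp hc).const_smul ε
    simpa [cellForcing, forcing, actL_apply] using this
  refine ⟨hc.continuousOn, hi 0 L, fun t _ => ?_⟩
  rw [intervalIntegral.integral_eq_sub_of_hasDerivAt (fun s _ => hd s) (hi 0 t)]
  simp [act]

end Flow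

/-! ### From the error bound to a bounded mean deviation. -/

section ErrorBound

variable {n : ℕ}

theorem forcing_zero (A : Mat n) (t : ℝ) : forcing A 0 t = 0 := by
  simp [forcing, act]

theorem maxNorm_le {u : ℝ → Vec n} {t c : ℝ} (hc : 0 ≤ c) (h : ∀ s ∈ Icc 0 t, ‖u s‖ ≤ c) :
    maxNorm u t ≤ c :=
  Real.sSup_le (by rintro _ ⟨s, hs, rfl⟩; exact h s hs) hc

theorem exists_norm_exp_smul_le (B : Mat n) (T : ℝ) :
    ∃ K, 0 ≤ K ∧ ∀ s ∈ Icc 0 T, ‖NormedSpace.exp (s • B)‖ ≤ K := by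
  obtain ⟨K, hK⟩ := (isCompact_Icc (a := (0 : ℝ)) (b := T)).exists_bound_of_continuousOn
    (continuous_exp_smul B).continuousOn
  exact ⟨max K 0, le_max_right _ _, fun s hs => (hK s hs).trans (le_max_left _ _)⟩

theorem exists_norm_exp_smul_sub_one_le (B : Mat n) (T : ℝ) :
    ∃ K, 0 ≤ K ∧ ∀ s ∈ Icc 0 T, ‖NormedSpace.exp (s • B) - 1‖ ≤ K * s := by
  obtain ⟨K, hK0, hK⟩ := exists_norm_exp_smul_le B T
  refine ⟨‖B‖ * K, by positivity, fun s hs => ?_⟩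
  have h := (convex_Icc 0 T).norm_image_sub_le_of_norm_hasDerivWithin_le
    (fun t _ => (hasDerivAt_exp_smul B t).hasDerivWithinAt) (C := ‖B‖ * K)
    (fun t ht => (norm_mul_le _ _).trans (mul_le_mul_of_nonneg_left (hK t ht) (norm_nonneg _)))
    ⟨le_rfl, hs.1.trans hs.2⟩ hs
  rwa [zero_smul, NormedSpace.exp_zero, sub_zero, Real.norm_of_nonneg hs.1] at h

theorem norm_actL (M : Mat n) : ‖actL n M‖ = ‖M‖ := Matrix.l2_opNorm_toEuclideanCLM M

theorem intervalIntegrable_act {Q : ℝ → Mat n} {a b : ℝ} (hQ : IntervalIntegrable Q volume a b)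
    {y : ℝ → Vec n} (hy : Continuous y) :
    IntervalIntegrable (fun s => act (Q s) (y s)) volume a b :=
  IntervalIntegrable.clm_apply_continuous (R := fun s => actL n (Q s))
    ⟨(actL n).integrable_comp hQ.1, (actL n).integrable_comp hQ.2⟩ hy

/-- A relative error bound forces `e^{-At} P(t) e^{At} x₀` to have bounded deviation from `B x₀` in
mean. -/
theorem RelativeErrorBound.exists_norm_integral_sub_le {A : Mat n} {P : ℝ → Mat n} {B : Mat n}
    {x₀ : Vec n} {Cbar : ℝ} (hCbar : 0 < Cbar) (h : RelativeErrorBound A P 0 B x₀ Cbar)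
    (hP : ∀ a b, IntervalIntegrable P volume a b)
    (hP2 : ∀ a b, IntervalIntegrable (fun s => ‖P s‖ ^ 2) volume a b) :
    ∃ D : ℝ, ∀ t, 0 ≤ t → ‖(∫ s in (0 : ℝ)..t, act (conj A P s) x₀) - t • act B x₀‖ ≤ D := by
  obtain ⟨C, ε₀, hε₀, h⟩ := h
  obtain ⟨K, hK0, hK⟩ := exists_norm_exp_smul_le B Cbar
  obtain ⟨K₁, hK₁0, hK₁⟩ := exists_norm_exp_smul_sub_one_le B Cbar
  -- `K` bounds `exp(sB)` for `s = ετ ≤ Cbar`, so `D` depends on neither `t` nor `ε`.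
  set D := |C| * (K * ‖x₀‖) with hD
  have hD0 : 0 ≤ D := by positivity
  refine ⟨D, fun t ht => ?_⟩
  set Q := conj A P
  have hQ (a b) : IntervalIntegrable Q volume a b := intervalIntegrable_conj (hP a b)
  set S := ∫ s in (0 : ℝ)..t, ‖Q s‖
  set I := ∫ s in (0 : ℝ)..t, act (Q s) x₀
  let Ω (ε s : ℝ) : Vec n := act (NormedSpace.exp (s • (ε • B))) x₀
  -- The limit is the derivative of `ε ↦ exp(tεB) x₀` at `0`.
  have hlim : Tendsto (fun ε : ℝ => ‖I - ε⁻¹ • (Ω ε t - x₀)‖) (𝓝[>] 0)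
      (𝓝 ‖I - t • act B x₀‖) := by
    have hd : HasDerivAt (fun ε => Ω ε t) (t • act B x₀) 0 := by
      have h1 := ((hasDerivAt_actL_exp_smul (t • B) 0).clm_apply (hasDerivAt_const 0 x₀))
      have h2 : (fun ε => Ω ε t) = fun ε => actL n (NormedSpace.exp (ε • (t • B))) x₀ := by
        funext ε; simp only [Ω, smul_comm t ε B]; rfl
      rw [h2]
      refine h1.congr_deriv ?_
      simp [actL_apply, act]
    have hs := hd.tendsto_slope_zero_right
    have : Ω 0 t = x₀ := by simp [Ω, act]
    simp only [zero_add, this] at hs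
    exact (hs.const_sub I).norm
  -- `S` and `K₁ * t` may grow with `t`; since `t` is fixed as `ε → 0`, only `D` survives.
  have hbd : Tendsto (fun ε : ℝ => D + ε * (S * (D + K₁ * t * ‖x₀‖))) (𝓝[>] 0) (𝓝 D) := by
    have : Continuous fun ε : ℝ => D + ε * (S * (D + K₁ * t * ‖x₀‖)) := by fun_prop
    have := this.tendsto 0
    simp only [zero_mul, add_zero] at this
    exact this.mono_left nhdsWithin_le_nhds
  refine le_of_tendsto_of_tendsto hlim hbd ?_
  have hsmall : ∀ᶠ ε : ℝ in 𝓝[>] 0, t * ε < Cbar := by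
    have : Continuous fun ε : ℝ => t * ε := by fun_prop
    have := this.tendsto 0
    rw [mul_zero] at this
    exact (this.mono_left nhdsWithin_le_nhds).eventually_lt_const hCbar
  filter_upwards [self_mem_nhdsWithin, hsmall, Ioo_mem_nhdsGT hε₀] with ε hε htε hεε₀
  replace hε : 0 < ε := hε
  have hL : 0 ≤ Cbar / ε := by positivity
  have htL : t ≤ Cbar / ε := (le_div_iff₀ hε).2 htε.le
  obtain ⟨y, hyc, hy, hsol⟩ := exists_solvesSystem A ε x₀ hL (hP _ _) (hP2 _ _)
  have herr : ∀ s ∈ Icc 0 (Cbar / ε), ‖y s - Ω ε s‖ ≤ D * ε := by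
    intro s hs
    have h1 := h ε hε hεε₀.2 _ _ hsol (solvesCell_exp A P B ε x₀ _) s hs
    have h2 : maxNorm (Ω ε) s ≤ K * ‖x₀‖ := by
      refine maxNorm_le (by positivity) fun r hr => ?_
      refine (norm_act_le _ _).trans (mul_le_mul_of_nonneg_right ?_ (norm_nonneg _))
      rw [smul_smul]
      exact hK _ ⟨mul_nonneg hr.1 hε.le, (le_div_iff₀ hε).1 (hr.2.trans hs.2)⟩
    have h3 : maxNorm (forcing A (0 : ℝ → Vec n)) s ≤ 0 :=
      maxNorm_le le_rfl fun r _ => by rw [forcing_zero, norm_zero]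
    have h4 : 0 ≤ maxNorm (Ω ε) s :=
      Real.sSup_nonneg (by rintro _ ⟨r, _, rfl⟩; exact norm_nonneg _)
    have h5 : 0 ≤ maxNorm (forcing A (0 : ℝ → Vec n)) s :=
      Real.sSup_nonneg (by rintro _ ⟨r, _, rfl⟩; exact norm_nonneg _)
    have h6 : err A 0 (fun t => act (NormedSpace.exp (t • A)) (y t)) (Ω ε) s = y s - Ω ε s := by
      simp only [err]
      rw [forcing_zero, sub_zero, ← act_mul, exp_neg_mul_exp, act_one]
    rw [← h6]
    refine h1.trans ?_
    calc C * ε * (maxNorm (Ω ε) s + maxNorm (forcing A 0) s)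
        ≤ |C| * ε * (K * ‖x₀‖) := by
          refine mul_le_mul (mul_le_mul_of_nonneg_right (le_abs_self C) hε.le) (by linarith)
            (by linarith) (by positivity)
      _ = D * ε := by rw [hD]; ring
  -- On the fixed interval `[0, t]` the solution is `O(ε)`-close to `x₀`, so `y` may be replaced by
  -- `x₀` under the integral.
  have hclose : ∀ s ∈ Icc 0 t, ‖y s - x₀‖ ≤ ε * (D + K₁ * t * ‖x₀‖) := by
    intro s hs
    have h1 := herr s ⟨hs.1, hs.2.trans htL⟩
    have h2 : ‖Ω ε s - x₀‖ ≤ K₁ * (s * ε) * ‖x₀‖ := by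
      have : Ω ε s - x₀ = act (NormedSpace.exp ((s * ε) • B) - 1) x₀ := by
        simp [Ω, act, smul_smul]
      rw [this]
      refine (norm_act_le _ _).trans (mul_le_mul_of_nonneg_right (hK₁ _ ?_) (norm_nonneg _))
      exact ⟨mul_nonneg hs.1 hε.le, (mul_le_mul_of_nonneg_right hs.2 hε.le).trans htε.le⟩
    have h3 : K₁ * (s * ε) * ‖x₀‖ ≤ K₁ * (t * ε) * ‖x₀‖ := by
      have := hs.2
      gcongr
    calc ‖y s - x₀‖ ≤ ‖y s - Ω ε s‖ + ‖Ω ε s - x₀‖ := norm_sub_le_norm_sub_add_norm_sub _ _ _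
      _ ≤ D * ε + K₁ * (t * ε) * ‖x₀‖ := by linarith
      _ = _ := by ring
  have hIy : ‖I - ∫ s in (0 : ℝ)..t, act (Q s) (y s)‖ ≤ ε * (S * (D + K₁ * t * ‖x₀‖)) := by
    rw [← intervalIntegral.integral_sub (intervalIntegrable_act (hQ _ _) continuous_const)
      (intervalIntegrable_act (hQ _ _) hyc)]
    have : ε * (S * (D + K₁ * t * ‖x₀‖)) =
        ∫ s in (0 : ℝ)..t, ‖Q s‖ * (ε * (D + K₁ * t * ‖x₀‖)) := by
      rw [intervalIntegral.integral_mul_const]; ring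
    rw [this]
    refine intervalIntegral.norm_integral_le_of_norm_le ht (Eventually.of_forall fun s hs => ?_)
      ((hQ 0 t).norm.mul_const _)
    have h1 : act (Q s) x₀ - act (Q s) (y s) = act (Q s) (x₀ - y s) := (map_sub _ _ _).symm
    rw [h1]
    refine (norm_act_le _ _).trans (mul_le_mul_of_nonneg_left ?_ (norm_nonneg _))
    rw [norm_sub_rev]
    exact hclose s (Ioc_subset_Icc_self hs)
  have hyt : ∫ s in (0 : ℝ)..t, act (Q s) (y s) = ε⁻¹ • (y t - x₀) := by
    rw [hy t ⟨ht, htL⟩, add_sub_cancel_left, inv_smul_smul₀ hε.ne']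
  have hlast : ‖ε⁻¹ • (y t - x₀) - ε⁻¹ • (Ω ε t - x₀)‖ ≤ D := by
    rw [← smul_sub, sub_sub_sub_cancel_right, norm_smul, Real.norm_of_nonneg (by positivity),
      inv_mul_le_iff₀ hε, mul_comm]
    exact herr t ⟨ht, htL⟩
  rw [← hyt] at hlast
  calc ‖I - ε⁻¹ • (Ω ε t - x₀)‖ ≤ _ := norm_sub_le_norm_sub_add_norm_sub _ _ _
    _ ≤ ε * (S * (D + K₁ * t * ‖x₀‖)) + D := add_le_add hIy hlast
    _ = _ := add_comm _ _

end ErrorBound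

/-! ### Subspaces of vectors with bounded orbit. -/

section BoundedOrbits

variable {V : Type*} [NormedAddCommGroup V] [NormedSpace ℝ V]

/-- The vectors with bounded orbit under a family of operators. -/
def boundedOrbit {ι : Type*} (g : ι → V →L[ℝ] V) : Submodule ℝ V where
  carrier := {v | ∃ D : ℝ, ∀ k, ‖g k v‖ ≤ D}
  zero_mem' := ⟨0, fun k => by simp⟩
  add_mem' := by
    rintro v w ⟨D, hD⟩ ⟨D', hD'⟩
    refine ⟨D + D', fun k => ?_⟩
    rw [map_add]
    exact (norm_add_le _ _).trans (add_le_add (hD k) (hD' k))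
  smul_mem' := by
    rintro c v ⟨D, hD⟩
    refine ⟨‖c‖ * D, fun k => ?_⟩
    rw [map_smul, norm_smul]
    exact mul_le_mul_of_nonneg_left (hD k) (norm_nonneg _)

/-- The subspace is finite-dimensional, hence complete, so Banach–Steinhaus applies to the
restricted family even if the operators are unbounded as a family on `V`. -/
theorem exists_norm_le_of_mem_boundedOrbit [FiniteDimensional ℝ V] {ι : Type*}
    (g : ι → V →L[ℝ] V) : ∃ K, 0 ≤ K ∧ ∀ v ∈ boundedOrbit g, ∀ k, ‖g k v‖ ≤ K * ‖v‖ := by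
  have := FiniteDimensional.complete ℝ (boundedOrbit g)
  obtain ⟨K, hK⟩ := banach_steinhaus (g := fun k => (g k).comp (boundedOrbit g).subtypeL)
    fun v => v.2
  refine ⟨max K 0, le_max_right _ _, fun v hv k => ?_⟩
  refine (((g k).comp (boundedOrbit g).subtypeL).le_opNorm ⟨v, hv⟩).trans ?_
  exact mul_le_mul_of_nonneg_right ((hK k).trans (le_max_left _ _)) (norm_nonneg _)

/-- Right difference quotients suffice, so membership is needed only to the right of `t`; this also
covers `t = 0` later. -/
theorem mem_of_hasDerivAt_of_ge {W : Submodule ℝ V} (hW : IsClosed (W : Set V)) {G : ℝ → V}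
    {v : V} {t : ℝ} (hG : ∀ s, t ≤ s → G s ∈ W) (h : HasDerivAt G v t) : v ∈ W := by
  refine hW.mem_of_tendsto h.tendsto_slope_zero_right ?_
  filter_upwards [self_mem_nhdsWithin] with s hs
  exact W.smul_mem _ (W.sub_mem (hG _ (le_add_of_nonneg_right (le_of_lt hs))) (hG _ le_rfl))

end BoundedOrbits

/-! ### Conjugation by the flow, and periodicity. -/

section Conjugation

variable {n : ℕ}

/-- Conjugation `M ↦ e^{-tA} M e^{tA}`. -/
def conjL (A : Mat n) (t : ℝ) : Mat n →L[ℝ] Mat n :=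
  ContinuousLinearMap.mulLeftRight ℝ (Mat n) (NormedSpace.exp (-(t • A))) (NormedSpace.exp (t • A))

theorem conjL_apply (A : Mat n) (t : ℝ) (M : Mat n) :
    conjL A t M = NormedSpace.exp (-(t • A)) * M * NormedSpace.exp (t • A) := rfl

theorem conj_eq_conjL (A : Mat n) (P : ℝ → Mat n) (t : ℝ) : conj A P t = conjL A t (P t) := rfl

theorem conjL_add (A : Mat n) (s t : ℝ) (M : Mat n) :
    conjL A (s + t) M = conjL A s (conjL A t M) := by
  simp only [conjL_apply, ← smul_neg]
  rw [exp_add_smul (-A), add_comm s t, exp_add_smul A]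
  simp only [mul_assoc]

theorem conjL_zero (A : Mat n) (M : Mat n) : conjL A 0 M = M := by
  simp [conjL_apply]

theorem exists_norm_conjL_le (A : Mat n) (T : ℝ) :
    ∃ K, 0 ≤ K ∧ ∀ t ∈ Icc 0 T, ∀ M, ‖conjL A t M‖ ≤ K * ‖M‖ := by
  obtain ⟨K, hK0, hK⟩ := exists_norm_exp_smul_le A T
  obtain ⟨K', hK0', hK'⟩ := exists_norm_exp_smul_le (-A) T
  refine ⟨K' * K, by positivity, fun t ht M => ?_⟩
  have h1 := hK t ht
  have h2 := hK' t ht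
  rw [smul_neg] at h2
  calc ‖conjL A t M‖ ≤ ‖NormedSpace.exp (-(t • A))‖ * ‖M‖ * ‖NormedSpace.exp (t • A)‖ :=
        norm_mul₃_le
    _ ≤ K' * ‖M‖ * K := by gcongr
    _ = K' * K * ‖M‖ := by ring

/-- Conjugations at different times commute. The time `s` may be negative, which allows passing from
`conj A P t` back to `P t`. -/
theorem conjL_mem_boundedOrbit (A : Mat n) (T s : ℝ) {M : Mat n}
    (hM : M ∈ boundedOrbit fun k : ℕ => conjL A (k * T)) :
    conjL A s M ∈ boundedOrbit fun k : ℕ => conjL A (k * T) := by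
  obtain ⟨D, hD⟩ := hM
  refine ⟨‖conjL A s‖ * D, fun k => ?_⟩
  rw [← conjL_add, add_comm, conjL_add]
  exact ((conjL A s).le_opNorm _).trans (mul_le_mul_of_nonneg_left (hD k) (norm_nonneg _))

theorem conj_add_nat_mul {A : Mat n} {P : ℝ → Mat n} {T : ℝ} (hper : Function.Periodic P T)
    (k : ℕ) (t : ℝ) : conj A P (t + k * T) = conjL A (k * T) (conj A P t) := by
  rw [conj_eq_conjL, conj_eq_conjL, hper.nat_mul k t, add_comm, conjL_add]

/-- The constants depend on `x₀`; Banach–Steinhaus over the family indexed by `t ≥ 0` makes them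
uniform. -/
theorem exists_norm_integral_conj_sub_le {A : Mat n} {P : ℝ → Mat n} {B : Mat n}
    (hP : ∀ a b, IntervalIntegrable P volume a b)
    (h : ∀ x₀ : Vec n, ∃ D : ℝ, ∀ t, 0 ≤ t →
      ‖(∫ s in (0 : ℝ)..t, act (conj A P s) x₀) - t • act B x₀‖ ≤ D) :
    ∃ D : ℝ, ∀ t, 0 ≤ t → ‖(∫ s in (0 : ℝ)..t, conj A P s) - t • B‖ ≤ D := by
  have hQ (a b) := intervalIntegrable_conj (A := A) (hP a b)
  obtain ⟨D, hD⟩ := banach_steinhaus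
    (g := fun t : Ici (0 : ℝ) => actL n ((∫ s in (0 : ℝ)..t, conj A P s) - (t : ℝ) • B)) (by
      intro x₀
      obtain ⟨D, hD⟩ := h x₀
      refine ⟨D, fun t => ?_⟩
      have h1 : actL n (∫ s in (0 : ℝ)..t, conj A P s) x₀ =
          ∫ s in (0 : ℝ)..t, act (conj A P s) x₀ :=
        (((actL n).flip x₀).intervalIntegral_comp_comm (hQ 0 t)).symm
      rw [map_sub, sub_apply, h1, map_smul, smul_apply]
      exact hD t t.2)
  refine ⟨D, fun t ht => ?_⟩
  rw [← norm_actL]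
  exact hD ⟨t, ht⟩

/-- The image under `conjL A (k * T)` is a difference of two primitives, whose linear drifts cancel
up to the fixed term `t • B`. -/
theorem integral_conj_mem_boundedOrbit {A : Mat n} {P : ℝ → Mat n} {B : Mat n} {T D : ℝ}
    (hT : 0 ≤ T) (hper : Function.Periodic P T) (hP : ∀ a b, IntervalIntegrable P volume a b)
    (hD : ∀ t, 0 ≤ t → ‖(∫ s in (0 : ℝ)..t, conj A P s) - t • B‖ ≤ D) {t : ℝ} (ht : 0 ≤ t) :
    ∫ s in (0 : ℝ)..t, conj A P s ∈ boundedOrbit fun k : ℕ => conjL A (k * T) := by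
  have hQ (a b) := intervalIntegrable_conj (A := A) (hP a b)
  refine ⟨D + D + ‖t • B‖, fun k => ?_⟩
  have hkT : 0 ≤ k * T := by positivity
  have h1 : conjL A (k * T) (∫ s in (0 : ℝ)..t, conj A P s) =
      (∫ s in (0 : ℝ)..(t + k * T), conj A P s) - ∫ s in (0 : ℝ)..(k * T), conj A P s := by
    rw [← ContinuousLinearMap.intervalIntegral_comp_comm _ (hQ 0 t),
      intervalIntegral.integral_interval_sub_left (hQ _ _) (hQ _ _)]
    simp_rw [← conj_add_nat_mul hper]
    rw [intervalIntegral.integral_comp_add_right, zero_add]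
  have h2 : conjL A (k * T) (∫ s in (0 : ℝ)..t, conj A P s) =
      ((∫ s in (0 : ℝ)..(t + k * T), conj A P s) - (t + k * T) • B) -
      ((∫ s in (0 : ℝ)..(k * T), conj A P s) - (k * T) • B) + t • B := by
    rw [h1, add_smul]; abel
  rw [h2]
  exact (norm_add_le _ _).trans (add_le_add_left ((norm_sub_le _ _).trans
    (add_le_add (hD _ (by positivity)) (hD _ hkT))) _)

theorem uniformlyBounded_of_norm_integral_sub_le {A : Mat n} {P : ℝ → Mat n} {B : Mat n} {T : ℝ}
    (hT : 0 < T) (hper : Function.Periodic P T) (hP : ∀ a b, IntervalIntegrable P volume a b)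
    {D : ℝ} (hD : ∀ t, 0 ≤ t → ‖(∫ s in (0 : ℝ)..t, conj A P s) - t • B‖ ≤ D) :
    UniformlyBounded A P := by
  have hQ (a b) := intervalIntegrable_conj (A := A) (hP a b)
  have hloc : LocallyIntegrable (conj A P) volume := by
    intro t
    refine ⟨Ioc (t - 1) (t + 1), Ioc_mem_nhds (by linarith) (by linarith), (hQ _ _).1⟩
  obtain ⟨K, hK0, hK⟩ := exists_norm_le_of_mem_boundedOrbit fun k : ℕ => conjL A (k * T)
  obtain ⟨K', hK0', hK'⟩ := exists_norm_conjL_le A T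
  refine ⟨K' * K, ?_⟩
  filter_upwards [ae_restrict_of_ae (LocallyIntegrable.ae_hasDerivAt_integral hloc),
    ae_restrict_mem measurableSet_Ici] with t hder ht
  have ht0 : 0 ≤ t := ht
  have hQt : conj A P t ∈ boundedOrbit fun k : ℕ => conjL A (k * T) :=
    mem_of_hasDerivAt_of_ge (Submodule.closed_of_finiteDimensional _)
      (fun s hs => integral_conj_mem_boundedOrbit hT.le hper hP hD (ht0.trans hs)) (hder 0)
  have hPt : P t ∈ boundedOrbit fun k : ℕ => conjL A (k * T) := by
    have := conjL_mem_boundedOrbit A T (-t) hQt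
    rwa [conj_eq_conjL, ← conjL_add, neg_add_cancel, conjL_zero] at this
  -- Whole periods are controlled by the orbit bound `K`, the remainder in `[0, T]` by compactness
  -- through `K'`.
  set k := ⌊t / T⌋₊
  have h1 : k * T ≤ t := (le_div_iff₀ hT).1 (Nat.floor_le (by positivity))
  have h2 : t ≤ (k + 1) * T := ((div_lt_iff₀ hT).1 (Nat.lt_floor_add_one _)).le
  have h3 : conj A P t = conjL A (t - k * T) (conjL A (k * T) (P t)) := by
    rw [← conjL_add, sub_add_cancel, conj_eq_conjL]
  calc ‖conj A P t‖ ≤ K' * ‖conjL A (k * T) (P t)‖ := by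
        rw [h3]; exact hK' _ ⟨by linarith, by linarith⟩ _
    _ ≤ K' * (K * ‖P t‖) := mul_le_mul_of_nonneg_left (hK _ hPt k) hK0'
    _ ≤ K' * K * (1 + ‖P t‖) := by
        have : 0 ≤ K' * K := by positivity
        linarith

end Conjugation

end TemporalHomogenization

end

theorem theorem2 {n : ℕ} (A : TemporalHomogenization.Mat n)
    (P : ℝ → TemporalHomogenization.Mat n) (ω : ℝ) (hω : 0 < ω)
    (hper : Function.Periodic P (2 * Real.pi / ω))
    (hL2 : MeasureTheory.MemLp P 2
      (MeasureTheory.volume.restrict (Set.Icc 0 (2 * Real.pi / ω))))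
    (hunb : ¬ TemporalHomogenization.UniformlyBounded A P)
    (B : TemporalHomogenization.Mat n) :
    ∃ x₀ : TemporalHomogenization.Vec n, ∀ Cbar : ℝ, 0 < Cbar →
      ¬ TemporalHomogenization.RelativeErrorBound A P 0 B x₀ Cbar := by
  by_contra! hcon
  have hT : 0 < 2 * Real.pi / ω := div_pos Real.two_pi_pos hω
  have hP : ∀ a b, IntervalIntegrable P MeasureTheory.volume a b := by
    refine hper.intervalIntegrable₀ hT.ne' ?_
    rw [intervalIntegrable_iff_integrableOn_Icc_of_le hT.le]
    exact hL2.integrable (by norm_num)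
  have hP2 : ∀ a b, IntervalIntegrable (fun s => ‖P s‖ ^ 2) MeasureTheory.volume a b := by
    have hper2 : Function.Periodic (fun s => ‖P s‖ ^ 2) (2 * Real.pi / ω) :=
      fun s => by simp only [hper s]
    refine hper2.intervalIntegrable₀ hT.ne' ?_
    rw [intervalIntegrable_iff_integrableOn_Icc_of_le hT.le]
    exact hL2.norm.integrable_sq
  obtain ⟨D, hD⟩ := TemporalHomogenization.exists_norm_integral_conj_sub_le (A := A) (B := B) hP
    fun x₀ => by
      -- `Cbar` may vary with `x₀`: it enters only the constant `D` for that `x₀`.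
      obtain ⟨Cbar, hCbar, h⟩ := hcon x₀
      exact h.exists_norm_integral_sub_le hCbar hP hP2
  exact hunb (TemporalHomogenization.uniformlyBounded_of_norm_integral_sub_le hT hper hP hD)
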